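/- Let $E=(E^0,E^1,r,s)$ be any directed graph, where $s,r:E^1\to E^0$ are the source and range maps. Let $E^*$ be the set of finite paths (composable sequences of edges, $r(\lambda_i)=s(\lambda_{i+1})$; the vertices are the paths of length $0$, with $s(v)=r(v)=v$), and let $E^\infty$ be the set of infinite paths. Label the edges by the alphabet $\mathcal A=E^1$ with labelling map $\mathcal L=\mathrm{id}$. The labelled paths are the empty word $\omega$ and the labels of paths of length at least $1$. For $A\subseteq E^0$ and a labelled path $\alpha$ let $r(A,\alpha)$ be the set of ranges of the paths with label $\alpha$ and source in $A$, with $r(A,\omega)=A$; let $r(\alpha)=r(E^0,\alpha)$. Let $\mathcal B$ be the family of all finite subsets of $E^0$. Then $\mathcal B$ is an accommodating family (closed under relative ranges, finite unions and intersections, and containing $r(\alpha)$ for every labelled path $\alpha\neq\omega$), it is closed under relative complements, and the labelled space $(E,\mathcal L,\mathcal B)$ is weakly left resolving, that is, $r(A\cap B,\alpha)=r(A,\alpha)\cap r(B,\alpha)$ for all $A,B\in\mathcal B$ and all labelled paths $\alpha\neq\omega$. Let $S$ be the inverse semigroup of this labelled space: it consists of a zero element $0$ and of the triples $(\alpha,A,\beta)$,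 where $\alpha,\beta$ are labelled paths and $\emptyset\ne A\in\mathcal B$ with $A\subseteq r(\alpha)\cap r(\beta)$. The product is $$(\alpha,A,\beta)(\gamma,B,\delta)=\begin{cases}(\alpha\gamma',\,r(A,\gamma')\cap B,\,\delta)&\text{if }\gamma=\beta\gamma',\\(\alpha,\,A\cap r(B,\beta'),\,\delta\beta')&\text{if }\beta=\gamma\beta',\\0&\text{otherwise,}\end{cases}$$ where a triple with empty middle entry is read as $0$. Let $E(S)$ be the semilattice of idempotents of $S$, with $p\wedge q=pq$ and $p\le q$ if and only if $pq=p$. A character of $E(S)$ is a nonzero map $\phi:E(S)\to\{0,1\}$ with $\phi(0)=0$ and $\phi(p\wedge q)=\phi(p)\wedge\phi(q)$. A set $Z\subseteq\{y: y\le x\}$ is a cover for $x$ if for every nonzero $y\le x$ there is $z\in Z$ with $z\wedge y\neq0$. The character $\phi$ is tight if $\bigvee_{z\in Z}\phi(z)=\phi(x)$ for every $x\in E(S)$ and every finite cover $Z$ for $x$. The tight spectrum of $E(S)$ is the set of tight characters with the topology of pointwise convergence. Let $\partial E=E^\infty\cup\{\lambda\in E^*: r(\lambda)\text{ is singular}\}$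 be the boundary path space, where a vertex $v$ is singular if $s^{-1}(v)$ is empty or infinite. Give $E^*\cup E^\infty$ the initial topology of the map $\theta:E^*\cup E^\infty\to\{0,1\}^{E^*}$, where $\theta(\lambda)(\mu)=1$ if $\mu$ is a beginning of $\lambda$ and $\theta(\lambda)(\mu)=0$ otherwise (a vertex $v$ is a beginning of $\lambda$ if and only if $s(\lambda)=v$), and give $\partial E$ the subspace topology. Then the tight spectrum of $E(S)$ is homeomorphic to $\partial E$. -/

import Mathlib

namespace LabelledSpaces

/-! ### Directed graphs, paths and the boundary path space -/

/-- A directed graph with vertex set `V` and edge set `E`. -/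
structure DirGraph (V E : Type*) where
  /-- the source map -/
  s : E → V
  /-- the range map -/
  r : E → V

namespace DirGraph

variable {V E : Type*} (G : DirGraph V E)

/-- `e₁ e₂ ⋯ eₙ` is a path that starts at `v`: `s e₁ = v` and `r eᵢ = s eᵢ₊₁`. -/
def IsPathFrom : V → List E → Prop
  | _, [] => True
  | v, e :: l => G.s e = v ∧ IsPathFrom (G.r e) l

/-- The last vertex of the path `e₁ e₂ ⋯ eₙ` that starts at `v`. -/
def endpoint : V → List E → V
  | v, [] => v
  | _, e :: l => endpoint (G.r e) l

/-- The set of finite paths. A path of length `0` is a vertex (`edges = []`); a path of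
length `n ≥ 1` is a composable list of edges, and then `src` is the source of the first one. -/
@[ext] structure FinPath where
  src : V
  edges : List E
  isPath : G.IsPathFrom src edges

/-- The range of a finite path. -/
def FinPath.range {G : DirGraph V E} (p : G.FinPath) : V := G.endpoint p.src p.edges

/-- The set of infinite paths. -/
def InfPath : Type _ := {f : ℕ → E // ∀ i, G.r (f i) = G.s (f (i + 1))}

/-- A vertex is singular if it is a sink or an infinite emitter. -/
def IsSingular (v : V) : Prop := {e | G.s e = v} = ∅ ∨ {e | G.s e = v}.Infinite

/-- The set of all finite and infinite paths. -/
inductive PathSpace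
  | fin (p : G.FinPath)
  | inf (p : G.InfPath)

/-- The finite path `μ` is a beginning of the path `x`. -/
def IsBeginning (μ : G.FinPath) : G.PathSpace → Prop
  | .fin p => μ.src = p.src ∧ μ.edges <+: p.edges
  | .inf p => μ.src = G.s (p.1 0) ∧ ∀ (i : ℕ) (h : i < μ.edges.length), μ.edges[i] = p.1 i

open Classical in
/-- The map to `{0,1}^{E^*}` with `theta x μ = 1` iff `μ` is a beginning of `x`. -/
noncomputable def theta (x : G.PathSpace) (μ : G.FinPath) : Bool := decide (G.IsBeginning μ x)

/-- The initial topology induced by `theta`. -/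
noncomputable instance : TopologicalSpace G.PathSpace :=
  TopologicalSpace.induced G.theta inferInstance

/-- The boundary path space: all infinite paths, and the finite paths that end in a singular
vertex. As a subtype it carries the subspace topology. -/
def boundary : Set G.PathSpace :=
  {x | (∃ p : G.InfPath, x = .inf p) ∨ ∃ p : G.FinPath, x = .fin p ∧ G.IsSingular p.range}

variable {G}

theorem isPathFrom_append {v : V} {l m : List E} :
    G.IsPathFrom v (l ++ m) ↔ G.IsPathFrom v l ∧ G.IsPathFrom (G.endpoint v l) m := by
  induction l generalizing v with
  | nil => simp [IsPathFrom, endpoint]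
  | cons e l ih => simp [IsPathFrom, endpoint, ih, and_assoc]

theorem endpoint_append {v : V} {l m : List E} :
    G.endpoint v (l ++ m) = G.endpoint (G.endpoint v l) m := by
  induction l generalizing v with
  | nil => rfl
  | cons e l ih => exact ih

end DirGraph

/-! ### Labelled graphs and labelled spaces -/

/-- A labelled graph over the alphabet `𝓐`. -/
structure LabelledGraph (V E 𝓐 : Type*) extends DirGraph V E where
  /-- the labelling map -/
  lab : E → 𝓐

namespace LabelledGraph

variable {V E 𝓐 : Type*} (L : LabelledGraph V E 𝓐)

/-- A finite word is a finite labelled path if it is empty or the label of a finite path. -/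
def IsLabelledPath (α : List 𝓐) : Prop :=
  α = [] ∨ ∃ p : L.toDirGraph.FinPath, p.edges.map L.lab = α

/-- The relative range `r(A, α)`: the set of ranges of the paths with label `α` and source in
`A`. For the empty word this is `A`, see `relRange_nil`. -/
def relRange (A : Set V) (α : List 𝓐) : Set V :=
  {v | ∃ p : L.toDirGraph.FinPath, p.edges.map L.lab = α ∧ p.src ∈ A ∧ p.range = v}

/-- The range of a word, `r(α) = r(E^0, α)`. -/
def wordRange (α : List 𝓐) : Set V := L.relRange Set.univ α

/-- `𝓑` is an accommodating family of sets of vertices. -/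
structure IsAccommodating (𝓑 : Set (Set V)) : Prop where
  relRange_mem : ∀ A ∈ 𝓑, ∀ α, L.IsLabelledPath α → L.relRange A α ∈ 𝓑
  inter_mem : ∀ A ∈ 𝓑, ∀ B ∈ 𝓑, A ∩ B ∈ 𝓑
  union_mem : ∀ A ∈ 𝓑, ∀ B ∈ 𝓑, A ∪ B ∈ 𝓑
  wordRange_mem : ∀ α, α ≠ [] → L.IsLabelledPath α → L.wordRange α ∈ 𝓑

/-- Weakly left resolving: `r(A ∩ B, α) = r(A, α) ∩ r(B, α)` for `A, B ∈ 𝓑` and all labelled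
paths `α` of positive length. -/
def IsWeaklyLeftResolving (𝓑 : Set (Set V)) : Prop :=
  ∀ A ∈ 𝓑, ∀ B ∈ 𝓑, ∀ α, α ≠ [] → L.IsLabelledPath α →
    L.relRange (A ∩ B) α = L.relRange A α ∩ L.relRange B α

variable {L}

theorem relRange_nil (A : Set V) : L.relRange A [] = A := by
  ext v
  constructor
  · rintro ⟨⟨w, l, hl⟩, h1, h2, rfl⟩
    obtain rfl : l = [] := by simpa using h1
    exact h2
  · intro hv
    exact ⟨⟨v, [], trivial⟩, rfl, hv, rfl⟩

theorem relRange_append (A : Set V) (α β : List 𝓐) :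
    L.relRange A (α ++ β) = L.relRange (L.relRange A α) β := by
  ext v
  constructor
  · rintro ⟨⟨w, l, hl⟩, h1, h2, rfl⟩
    obtain ⟨l₁, l₂, rfl, rfl, rfl⟩ := List.map_eq_append_iff.1 h1
    obtain ⟨ha, hb⟩ := DirGraph.isPathFrom_append.1 hl
    exact ⟨⟨_, l₂, hb⟩, rfl, ⟨⟨w, l₁, ha⟩, rfl, h2, rfl⟩, DirGraph.endpoint_append.symm⟩
  · rintro ⟨⟨w, l₂, hb⟩, rfl, ⟨⟨u, l₁, ha⟩, rfl, h2, rfl⟩, rfl⟩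
    exact ⟨⟨u, l₁ ++ l₂, DirGraph.isPathFrom_append.2 ⟨ha, hb⟩⟩, by simp, h2,
      DirGraph.endpoint_append⟩

theorem relRange_mono {A B : Set V} (h : A ⊆ B) (α : List 𝓐) :
    L.relRange A α ⊆ L.relRange B α := by
  rintro v ⟨p, h1, h2, h3⟩
  exact ⟨p, h1, h h2, h3⟩

theorem isLabelledPath_of_mem {A : Set V} {α : List 𝓐} {v : V} (h : v ∈ L.relRange A α) :
    L.IsLabelledPath α := by
  obtain ⟨p, h1, -⟩ := h
  exact Or.inr ⟨p, h1⟩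

theorem relRange_inter {𝓑 : Set (Set V)} (hw : L.IsWeaklyLeftResolving 𝓑) {A B : Set V}
    (hA : A ∈ 𝓑) (hB : B ∈ 𝓑) (α : List 𝓐) :
    L.relRange (A ∩ B) α = L.relRange A α ∩ L.relRange B α := by
  by_cases h0 : α = []
  · subst h0
    simp [relRange_nil]
  by_cases hα : L.IsLabelledPath α
  · exact hw A hA B hB α h0 hα
  · ext v
    constructor
    · intro hv
      exact absurd (isLabelledPath_of_mem hv) hα
    · intro hv
      exact absurd (isLabelledPath_of_mem hv.1) hα

end LabelledGraph

/-- A labelled space: a labelled graph with an accommodating family. -/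
structure LabelledSpace (V E 𝓐 : Type*) extends LabelledGraph V E 𝓐 where
  /-- the accommodating family -/
  acf : Set (Set V)
  accommodating : toLabelledGraph.IsAccommodating acf

/-! ### Inverse semigroups with zero and their idempotents -/

/-- An inverse semigroup with zero. -/
class InverseSemigroupWithZero (S : Type*) extends SemigroupWithZero S where
  existsUnique_inverse : ∀ s : S, ∃! t : S, s * t * s = s ∧ t * s * t = t

/-- The set of idempotents of an inverse semigroup. -/
def Idempotents (S : Type*) [InverseSemigroupWithZero S] : Type _ := {e : S // e * e = e}

theorem idempotent_mul_idempotent {S : Type*} [InverseSemigroupWithZero S] {e f : S}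
    (he : e * e = e) (hf : f * f = f) : (e * f) * (e * f) = e * f := by
  obtain ⟨x, ⟨h1, h2⟩, hu⟩ := InverseSemigroupWithZero.existsUnique_inverse (e * f)
  have he' : ∀ y, e * (e * y) = e * y := fun y => by rw [← mul_assoc, he]
  have hf' : ∀ y, f * (f * y) = f * y := fun y => by rw [← mul_assoc, hf]
  simp only [mul_assoc] at h1 h2
  have h2' : ∀ y, x * (e * (f * (x * y))) = x * y := fun y => by
    simpa only [mul_assoc] using congrArg (· * y) h2
  have h3 : f * (x * e) = x := hu _ ⟨by simp only [mul_assoc, he', hf', h1], by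
    simp only [mul_assoc, he', hf', h2']⟩
  have h4 : x * x = x := by
    have h5 : f * (x * e) * (f * (x * e)) = f * (x * e) := by
      simp only [mul_assoc, h2']
    rwa [h3] at h5
  obtain ⟨y, -, hy⟩ := InverseSemigroupWithZero.existsUnique_inverse x
  have h6 : e * f = x :=
    (hy (e * f) ⟨by simpa only [mul_assoc] using h2, by simpa only [mul_assoc] using h1⟩).trans
      (hy x ⟨by rw [h4, h4], by rw [h4, h4]⟩).symm
  rw [h6, h4]

theorem idempotent_commute {S : Type*} [InverseSemigroupWithZero S] {e f : S}
    (he : e * e = e) (hf : f * f = f) : e * f = f * e := by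
  have h1 := idempotent_mul_idempotent he hf
  have h2 := idempotent_mul_idempotent hf he
  have he' : ∀ y, e * (e * y) = e * y := fun y => by rw [← mul_assoc, he]
  have hf' : ∀ y, f * (f * y) = f * y := fun y => by rw [← mul_assoc, hf]
  obtain ⟨y, -, hy⟩ := InverseSemigroupWithZero.existsUnique_inverse (e * f)
  refine (hy (e * f) ⟨by rw [h1, h1], by rw [h1, h1]⟩).trans (hy (f * e) ⟨?_, ?_⟩).symm
  · simp only [mul_assoc] at h1 ⊢
    simp only [he', hf', h1]
  · simp only [mul_assoc] at h2 ⊢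
    simp only [he', hf', h2]

/-- The idempotents form a semilattice with `p ≤ q ↔ p * q = p` and meet `p * q`. -/
instance {S : Type*} [InverseSemigroupWithZero S] : SemilatticeInf (Idempotents S) where
  le p q := p.1 * q.1 = p.1
  le_refl p := p.2
  le_trans p q t h1 h2 := by
    change p.1 * q.1 = p.1 at h1
    change q.1 * t.1 = q.1 at h2
    rw [← h1, mul_assoc, h2]
  le_antisymm p q h1 h2 := Subtype.ext (by
    change p.1 * q.1 = p.1 at h1
    change q.1 * p.1 = q.1 at h2
    rw [← h1, idempotent_commute p.2 q.2, h2])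
  inf p q := ⟨p.1 * q.1, idempotent_mul_idempotent p.2 q.2⟩
  inf_le_left p q := by
    change p.1 * q.1 * p.1 = p.1 * q.1
    rw [mul_assoc, idempotent_commute q.2 p.2, ← mul_assoc, p.2]
  inf_le_right p q := by
    change p.1 * q.1 * q.1 = p.1 * q.1
    rw [mul_assoc, q.2]
  le_inf p q t h1 h2 := by
    change p.1 * q.1 = p.1 at h1
    change p.1 * t.1 = p.1 at h2
    change p.1 * (q.1 * t.1) = p.1
    rw [← mul_assoc, h1, h2]

instance {S : Type*} [InverseSemigroupWithZero S] : OrderBot (Idempotents S) where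
  bot := ⟨0, mul_zero 0⟩
  bot_le p := zero_mul p.1

/-! ### Characters and the tight spectrum of a semilattice with zero -/

section Spectrum

variable {P : Type*} [SemilatticeInf P] [OrderBot P]

/-- A character: a nonzero map to `{0,1}` that preserves zero and meets. -/
structure IsCharacter (φ : P → Bool) : Prop where
  ne_zero : ∃ x, φ x ≠ ⊥
  map_bot : φ ⊥ = ⊥
  map_inf : ∀ x y, φ (x ⊓ y) = φ x ⊓ φ y

/-- `Z ⊆ ↓x` is a cover for `x`: each nonzero `y ≤ x` has nonzero meet with some `z ∈ Z`. -/
def IsCover (Z : Set P) (x : P) : Prop :=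
  (∀ z ∈ Z, z ≤ x) ∧ ∀ y, y ≤ x → y ≠ ⊥ → ∃ z ∈ Z, z ⊓ y ≠ ⊥

/-- A character is tight if `⋁_{z ∈ Z} φ z = φ x` for each finite cover `Z` of each `x`. -/
structure IsTight (φ : P → Bool) : Prop extends IsCharacter φ where
  sup_cover : ∀ (x : P) (Z : Finset P), IsCover (Z : Set P) x → Z.sup φ = φ x

variable (P) in
/-- The tight spectrum, with the topology of pointwise convergence (the subspace topology of
the product topology on `{0,1}^P`, where `{0,1}` is discrete). -/
def TightSpectrum : Type _ := {φ : P → Bool // IsTight φ}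

instance : TopologicalSpace (TightSpectrum P) :=
  inferInstanceAs (TopologicalSpace {φ : P → Bool // IsTight φ})

end Spectrum

/-! ### The inverse semigroup of a labelled space -/

namespace LabelledSpace

variable {V E 𝓐 : Type*} (L : LabelledSpace V E 𝓐)

/-- The nonzero elements: triples `(α, A, β)` with labelled paths `α`, `β` and a nonempty
`A` in the accommodating family such that `A ⊆ r(α) ∩ r(β)`. -/
structure IsTriple (α : List 𝓐) (A : Set V) (β : List 𝓐) : Prop where
  left_path : L.IsLabelledPath α
  right_path : L.IsLabelledPath β
  mem : A ∈ L.acf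
  subset_left : A ⊆ L.wordRange α
  subset_right : A ⊆ L.wordRange β
  nonempty : A.Nonempty

/-- The underlying set of the semigroup `S`: a zero element and the triples `(α, A, β)` with
`A ≠ ∅`. -/
inductive Semi
  | zero
  | triple (α : List 𝓐) (A : Set V) (β : List 𝓐) (h : L.IsTriple α A β)

namespace Semi

variable {L}

open Classical in
/-- The class of `(α, A, β)` in `S`, which is zero if `A = ∅`. -/
noncomputable def mk (α : List 𝓐) (A : Set V) (β : List 𝓐)
    (h : A.Nonempty → L.IsTriple α A β) : L.Semi :=
  if hA : A.Nonempty then .triple α A β (h hA) else .zero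

theorem isTriple_left {α γ' β δ : List 𝓐} {A B : Set V} (h : L.IsTriple α A β)
    (k : L.IsTriple (β ++ γ') B δ) (hn : (L.relRange A γ' ∩ B).Nonempty) :
    L.IsTriple (α ++ γ') (L.relRange A γ' ∩ B) δ := by
  obtain ⟨v, hv, hvB⟩ := hn
  have hsub : L.relRange A γ' ∩ B ⊆ L.wordRange (α ++ γ') := by
    intro w hw
    have := LabelledGraph.relRange_mono h.subset_left γ' hw.1
    rwa [LabelledGraph.wordRange, ← LabelledGraph.relRange_append] at this
  exact ⟨LabelledGraph.isLabelledPath_of_mem (hsub ⟨hv, hvB⟩), k.right_path,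
    L.accommodating.inter_mem _ (L.accommodating.relRange_mem _ h.mem _
      (LabelledGraph.isLabelledPath_of_mem hv)) _ k.mem,
    hsub, fun w hw => k.subset_right hw.2, ⟨v, hv, hvB⟩⟩

theorem IsTriple.symm {α β : List 𝓐} {A : Set V} (h : L.IsTriple α A β) : L.IsTriple β A α :=
  ⟨h.right_path, h.left_path, h.mem, h.subset_right, h.subset_left, h.nonempty⟩

theorem isTriple_right {α γ β' δ : List 𝓐} {A B : Set V} (h : L.IsTriple α A (γ ++ β'))
    (k : L.IsTriple γ B δ) (hn : (A ∩ L.relRange B β').Nonempty) :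
    L.IsTriple α (A ∩ L.relRange B β') (δ ++ β') := by
  rw [Set.inter_comm] at hn ⊢
  exact IsTriple.symm (isTriple_left (IsTriple.symm k) (IsTriple.symm h) hn)

open Classical in
/-- The product of `S`. With `γ = βγ'` in the first case and `β = γβ'` in the second one,
`(α, A, β)(γ, B, δ)` is `(αγ', r(A, γ') ∩ B, δ)`, respectively `(α, A ∩ r(B, β'), δβ')`, and it
is zero if `β` and `γ` are not comparable. -/
noncomputable def mul : L.Semi → L.Semi → L.Semi
  | .zero, _ => .zero
  | .triple _ _ _ _, .zero => .zero
  | .triple α A β h, .triple γ B δ k =>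
    if hγ : ∃ γ', γ = β ++ γ' then
      mk (α ++ hγ.choose) (L.relRange A hγ.choose ∩ B) δ
        (fun hn => isTriple_left h (hγ.choose_spec ▸ k) hn)
    else if hβ : ∃ β', β = γ ++ β' then
      mk α (A ∩ L.relRange B hβ.choose) (δ ++ hβ.choose)
        (fun hn => isTriple_right (hβ.choose_spec ▸ h) k hn)
    else .zero

noncomputable instance : Mul L.Semi := ⟨mul⟩

instance : Zero L.Semi := ⟨.zero⟩

/-- An auxiliary faithful representation of `S` by relations. -/
def SRel : L.Semi → List 𝓐 → V → List 𝓐 → Prop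
  | .zero, _, _, _ => False
  | .triple α A β _, p, v, q => ∃ μ, p = α ++ μ ∧ q = β ++ μ ∧ v ∈ L.relRange A μ

theorem rel_mk (α : List 𝓐) (A : Set V) (β : List 𝓐) (h : A.Nonempty → L.IsTriple α A β)
    (p : List 𝓐) (v : V) (q : List 𝓐) :
    SRel (mk α A β h) p v q ↔ ∃ μ, p = α ++ μ ∧ q = β ++ μ ∧ v ∈ L.relRange A μ := by
  by_cases hA : A.Nonempty
  · simp [mk, hA, SRel]
  · simp only [mk, hA, SRel, dite_false, false_iff]
    rintro ⟨μ, -, -, p, -, hp, -⟩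
    exact hA ⟨_, hp⟩

theorem rel_injective {x y : L.Semi} (h : ∀ p v q, SRel x p v q ↔ SRel y p v q) : x = y := by
  have base : ∀ (α : List 𝓐) (A : Set V) (β : List 𝓐) (hh : L.IsTriple α A β) (v : V),
      SRel (.triple α A β hh) α v β ↔ v ∈ A := by
    intro α A β hh v
    simp [SRel, LabelledGraph.relRange_nil]
  cases x with
  | zero =>
    cases y with
    | zero => rfl
    | triple α A β hh =>
      obtain ⟨v, hv⟩ := hh.nonempty
      exact ((h _ _ _).2 ((base α A β hh v).2 hv)).elim
  | triple α A β hh =>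
    obtain ⟨v, hv⟩ := hh.nonempty
    have h1 := (h _ _ _).1 ((base α A β hh v).2 hv)
    cases y with
    | zero => exact h1.elim
    | triple γ B δ kk =>
      obtain ⟨w, hw⟩ := kk.nonempty
      have h2 := (h _ _ _).2 ((base γ B δ kk w).2 hw)
      obtain ⟨μ, e1, e2, -⟩ := h1
      obtain ⟨ν, e3, e4, -⟩ := h2
      have e5 : μ = [] := by
        have := congrArg List.length e1
        have := congrArg List.length e3
        simp only [List.length_append] at *
        exact List.eq_nil_of_length_eq_zero (by omega)
      subst e5
      simp only [List.append_nil] at e1 e2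
      subst e1 e2
      have hAB : A = B := by
        ext u
        rw [← base _ A _ hh u, h, base]
      subst hAB
      rfl

theorem rel_mul (hw : L.IsWeaklyLeftResolving L.acf) (x y : L.Semi) (p : List 𝓐) (v : V)
    (t : List 𝓐) : SRel (x * y) p v t ↔ ∃ q, SRel x p v q ∧ SRel y q v t := by
  change SRel (mul x y) p v t ↔ _
  cases x with
  | zero => simp [mul, SRel]
  | triple α A β h =>
    cases y with
    | zero => simp [mul, SRel]
    | triple γ B δ k =>
      rw [mul]
      split_ifs with hγ hβ
      · rw [rel_mk]
        have hs := hγ.choose_spec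
        generalize hγ.choose = γ' at hs ⊢
        subst hs
        constructor
        · rintro ⟨μ, rfl, rfl, hv⟩
          refine ⟨β ++ (γ' ++ μ), ⟨γ' ++ μ, by simp, rfl, ?_⟩, ⟨μ, by simp, rfl, ?_⟩⟩
          · rw [LabelledGraph.relRange_append]
            exact LabelledGraph.relRange_mono Set.inter_subset_left _ hv
          · exact LabelledGraph.relRange_mono Set.inter_subset_right _ hv
        · rintro ⟨q, ⟨μ, rfl, rfl, hv⟩, ⟨ν, e, rfl, hv'⟩⟩
          rw [List.append_assoc, List.append_cancel_left_eq] at e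
          subst e
          refine ⟨ν, by simp, rfl, ?_⟩
          rw [LabelledGraph.relRange_append] at hv
          obtain ⟨a, -, ⟨b, hb, -⟩, -⟩ := id hv
          rw [LabelledGraph.relRange_inter hw (L.accommodating.relRange_mem _ h.mem _
            (Or.inr ⟨b, hb⟩)) k.mem]
          exact ⟨hv, hv'⟩
      · rw [rel_mk]
        have hs := hβ.choose_spec
        generalize hβ.choose = β' at hs ⊢
        subst hs
        constructor
        · rintro ⟨μ, rfl, rfl, hv⟩
          refine ⟨γ ++ (β' ++ μ), ⟨μ, rfl, by simp, ?_⟩, ⟨β' ++ μ, rfl, by simp, ?_⟩⟩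
          · exact LabelledGraph.relRange_mono Set.inter_subset_left _ hv
          · rw [LabelledGraph.relRange_append]
            exact LabelledGraph.relRange_mono Set.inter_subset_right _ hv
        · rintro ⟨q, ⟨μ, rfl, rfl, hv⟩, ⟨ν, e, rfl, hv'⟩⟩
          rw [List.append_assoc, List.append_cancel_left_eq] at e
          subst e
          refine ⟨μ, rfl, by simp, ?_⟩
          rw [LabelledGraph.relRange_append] at hv'
          obtain ⟨a, -, ⟨b, hb, -⟩, -⟩ := id hv'
          rw [LabelledGraph.relRange_inter hw h.mem (L.accommodating.relRange_mem _ k.mem _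
            (Or.inr ⟨b, hb⟩))]
          exact ⟨hv, hv'⟩
      · simp only [SRel, false_iff]
        rintro ⟨q, ⟨μ, -, rfl, -⟩, ⟨ν, e, -, -⟩⟩
        rcases List.append_eq_append_iff.1 e with ⟨a, ha, -⟩ | ⟨a, ha, -⟩
        · exact hγ ⟨a, ha⟩
        · exact hβ ⟨a, ha⟩

/-- The involution `(α, A, β)^* = (β, A, α)`. -/
def star : L.Semi → L.Semi
  | .zero => .zero
  | .triple α A β h => .triple β A α (IsTriple.symm h)

theorem rel_star (x : L.Semi) (p : List 𝓐) (v : V) (q : List 𝓐) :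
    SRel (star x) p v q ↔ SRel x q v p := by
  cases x with
  | zero => rfl
  | triple α A β h =>
    exact exists_congr fun μ => ⟨fun ⟨a, b, c⟩ => ⟨b, a, c⟩, fun ⟨a, b, c⟩ => ⟨b, a, c⟩⟩

theorem rel_unique {x : L.Semi} {p q q' : List 𝓐} {v w : V} (h : SRel x p v q)
    (h' : SRel x p w q') : q = q' := by
  cases x with
  | zero => exact h.elim
  | triple α A β k =>
    obtain ⟨μ, rfl, rfl, -⟩ := h
    obtain ⟨ν, e, rfl, -⟩ := h'
    rw [List.append_cancel_left_eq] at e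
    rw [e]

/-- If the labelled space is weakly left resolving, then `S` is an inverse semigroup. -/
@[reducible] noncomputable def inverseSemigroup (hw : L.IsWeaklyLeftResolving L.acf) :
    InverseSemigroupWithZero L.Semi where
  mul_assoc x y z := by
    apply rel_injective
    intro p v q
    simp only [rel_mul hw]
    constructor
    · rintro ⟨a, ⟨b, h1, h2⟩, h3⟩
      exact ⟨b, h1, a, h2, h3⟩
    · rintro ⟨b, h1, a, h2, h3⟩
      exact ⟨a, ⟨b, h1, h2⟩, h3⟩
  zero_mul x := rfl
  mul_zero x := by cases x <;> rfl
  existsUnique_inverse x := by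
    refine ⟨star x, ⟨?_, ?_⟩, ?_⟩
    · apply rel_injective
      intro p v q
      simp only [rel_mul hw, rel_star]
      constructor
      · rintro ⟨a, ⟨b, h1, h2⟩, h3⟩
        obtain rfl := rel_unique h2 h3
        exact h1
      · intro h
        exact ⟨p, ⟨q, h, h⟩, h⟩
    · apply rel_injective
      intro p v q
      simp only [rel_mul hw, rel_star]
      constructor
      · rintro ⟨a, ⟨b, h1, h2⟩, h3⟩
        obtain rfl := rel_unique h1 h2
        exact h3
      · intro h
        exact ⟨p, ⟨q, h, h⟩, h⟩
    · rintro y ⟨h1, h2⟩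
      have key : ∀ a b : L.Semi, a * b * a = a → ∀ p v q, SRel a p v q → SRel b q v p := by
        intro a b hab p v q h
        have h' := h
        rw [← hab] at h'
        simp only [rel_mul hw] at h'
        obtain ⟨c, ⟨d, e1, e2⟩, e3⟩ := h'
        obtain rfl := rel_unique h e1
        rw [← rel_star] at h e3
        obtain rfl := rel_unique h e3
        exact e2
      apply rel_injective
      intro p v q
      rw [rel_star]
      exact ⟨key y x h2 p v q, key x y h1 q v p⟩

end Semi

/-- The semilattice `E(S)` of a weakly left resolving labelled space. -/
abbrev ESemi (hw : L.IsWeaklyLeftResolving L.acf) : Type _ :=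
  @Idempotents L.Semi (Semi.inverseSemigroup hw)

end LabelledSpace

/-! ### A graph labelled by its own edges -/

namespace DirGraph

variable {V E : Type*} (G : DirGraph V E)

/-- The labelled graph with alphabet `E` and the identity as labelling map. -/
def selfLabelled : LabelledGraph V E E where
  toDirGraph := G
  lab := id

/-- The family of all finite sets of vertices. -/
def finiteSets (V : Type*) : Set (Set V) := {A | A.Finite}

theorem relRange_selfLabelled_finite (A : Set V) (hA : A.Finite) (α : List E) :
    (G.selfLabelled.relRange A α).Finite := by
  refine (hA.image fun v => G.endpoint v α).subset ?_
  rintro v ⟨⟨w, l, hl⟩, h1, h2, rfl⟩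
  obtain rfl : l = α := by simpa [selfLabelled] using h1
  exact ⟨w, h2, rfl⟩

theorem endpoint_congr (v w : V) {α : List E} (h : α ≠ []) :
    G.endpoint v α = G.endpoint w α := by
  cases α with
  | nil => exact absurd rfl h
  | cons e l => rfl

theorem finiteSets_isAccommodating : G.selfLabelled.IsAccommodating (finiteSets V) where
  relRange_mem A hA α _ := G.relRange_selfLabelled_finite A hA α
  inter_mem A hA _ _ := Set.Finite.inter_of_left hA _
  union_mem A hA B hB := Set.Finite.union hA hB
  wordRange_mem α h0 _ := by
    refine Set.Subsingleton.finite ?_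
    rintro _ ⟨⟨w, l, hl⟩, h1, -, rfl⟩ _ ⟨⟨w', l', hl'⟩, h1', -, rfl⟩
    obtain rfl : l = α := by simpa [selfLabelled] using h1
    obtain rfl : l' = l := by simpa [selfLabelled] using h1'
    exact endpoint_congr _ _ _ h0

theorem finiteSets_isWeaklyLeftResolving :
    G.selfLabelled.IsWeaklyLeftResolving (finiteSets V) := by
  intro A _ B _ α h0 _
  refine Set.Subset.antisymm (Set.subset_inter
    (LabelledGraph.relRange_mono Set.inter_subset_left _)
    (LabelledGraph.relRange_mono Set.inter_subset_right _)) ?_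
  rintro v ⟨⟨⟨w, l, hl⟩, h1, h2, h3⟩, ⟨⟨w', l', hl'⟩, h1', h2', -⟩⟩
  obtain rfl : l = α := by simpa [selfLabelled] using h1
  obtain rfl : l' = l := by simpa [selfLabelled] using h1'
  have hww : w = w' := by
    cases l' with
    | nil => exact absurd rfl h0
    | cons e l => exact hl.1.symm.trans hl'.1
  subst hww
  exact ⟨⟨w, l', hl⟩, h1, ⟨h2, h2'⟩, h3⟩

/-- The labelled space of a graph labelled by its own edges, with the finite sets of vertices
as accommodating family. -/
def labelledSpace : LabelledSpace V E E where
  toLabelledGraph := G.selfLabelled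
  acf := finiteSets V
  accommodating := G.finiteSets_isAccommodating

end DirGraph

end LabelledSpaces

namespace LabelledSpaces

namespace DirGraph

variable {V E : Type*} {G : DirGraph V E}

/-! ### Beginnings of paths -/

/-! A nonzero idempotent is a triple (α, A, α). It is represented by the set of finite paths that
extend some path with label α and range in A. Label and range determine a path
(`FinPath.ext_range`), so the finiteness of A makes this set a finite union of cylinders. Products
become intersections, and the cylinder of μ belongs to (μ, {r(μ)}, μ). This is `idempotentRep`; the
rest uses only such a representation. A path x gives the character that is 1 at e when some
beginning of x lies in the set of e. For x in the boundary it is tight: if none of the finitely many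
generators of a cover is a beginning of x, then `exists_incompatible` gives a path below the covered
element that is incompatible with all of them. Conversely, for a tight φ the paths μ with φ = 1 on
the cylinder of μ are pairwise compatible and closed under beginnings. At a regular vertex the
finitely many one-edge extensions form a cover, so one of them is again in this set. Hence these
paths are the beginnings of a boundary path (`exists_boundary_path`). The generators of e cover e,
so φ is determined by its values on cylinders. Those values are the coordinates of `theta`, which
gives continuity both ways. -/

theorem IsBeginning.refl (μ : G.FinPath) : G.IsBeginning μ (.fin μ) :=
  ⟨rfl, List.prefix_refl _⟩

theorem IsBeginning.trans {μ ν : G.FinPath} {x : G.PathSpace}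
    (h : G.IsBeginning μ (.fin ν)) (k : G.IsBeginning ν x) : G.IsBeginning μ x := by
  obtain ⟨h1, h2⟩ := h
  cases x with
  | fin p => exact ⟨h1.trans k.1, h2.trans k.2⟩
  | inf p =>
    refine ⟨h1.trans k.1, fun i hi => ?_⟩
    rw [h2.getElem hi]
    exact k.2 i _

theorem IsBeginning.total {μ ν : G.FinPath} {x : G.PathSpace}
    (h : G.IsBeginning μ x) (k : G.IsBeginning ν x) :
    G.IsBeginning μ (.fin ν) ∨ G.IsBeginning ν (.fin μ) := by
  cases x with
  | fin p =>
    exact (List.prefix_or_prefix_of_prefix h.2 k.2).imp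
      (fun l => ⟨h.1.trans k.1.symm, l⟩) (fun l => ⟨k.1.trans h.1.symm, l⟩)
  | inf p =>
    refine (le_total μ.edges.length ν.edges.length).imp
      (fun l => ⟨h.1.trans k.1.symm, ?_⟩) (fun l => ⟨k.1.trans h.1.symm, ?_⟩)
    · exact List.prefix_iff_getElem.2 ⟨l, fun i hi => (h.2 i hi).trans (k.2 i _).symm⟩
    · exact List.prefix_iff_getElem.2 ⟨l, fun i hi => (k.2 i hi).trans (h.2 i _).symm⟩

theorem IsBeginning.length_le {μ ν : G.FinPath} (h : G.IsBeginning μ (.fin ν)) :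
    μ.edges.length ≤ ν.edges.length := h.2.length_le

theorem IsBeginning.eq_of_length_le {μ ν : G.FinPath} (h : G.IsBeginning μ (.fin ν))
    (k : ν.edges.length ≤ μ.edges.length) : μ = ν :=
  FinPath.ext h.1 (h.2.eq_of_length (le_antisymm h.length_le k))

theorem IsPathFrom.source_getElem_zero {v : V} {l : List E} (h : G.IsPathFrom v l)
    (h0 : 0 < l.length) : G.s l[0] = v := by
  cases l with
  | nil => simp at h0
  | cons e l => exact h.1

theorem IsPathFrom.range_getElem {v : V} {l : List E} (h : G.IsPathFrom v l) (i : ℕ)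
    (hi : i + 1 < l.length) : G.r l[i] = G.s l[i + 1] := by
  induction l generalizing v i with
  | nil => simp at hi
  | cons e l ih =>
    cases i with
    | zero => exact (h.2.source_getElem_zero (by simpa using hi)).symm
    | succ i => exact ih h.2 i (by simpa using hi)

theorem isPathFrom_ofFn (p : ℕ → E) (hp : ∀ i, G.r (p i) = G.s (p (i + 1))) (n : ℕ) :
    G.IsPathFrom (G.s (p 0)) (List.ofFn fun i : Fin n => p i) := by
  induction n generalizing p with
  | zero => trivial
  | succ n ih =>
    rw [List.ofFn_succ]
    refine ⟨rfl, ?_⟩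
    -- The tail of `p` starts at the range of `p 0`, by `hp`.
    have := ih (fun i => p (i + 1)) (fun i => hp _)
    simpa [hp] using this

/-- The initial segment of length `n` of an infinite path. -/
def InfPath.initial (p : G.InfPath) (n : ℕ) : G.FinPath :=
  ⟨G.s (p.1 0), List.ofFn fun i : Fin n => p.1 i, isPathFrom_ofFn p.1 p.2 n⟩

theorem InfPath.length_initial (p : G.InfPath) (n : ℕ) :
    (p.initial n).edges.length = n := by simp [initial]

theorem InfPath.isBeginning_initial (p : G.InfPath) (n : ℕ) :
    G.IsBeginning (p.initial n) (.inf p) := by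
  refine ⟨rfl, fun i hi => ?_⟩
  simp [initial]

/-- The extension of a finite path by an edge. -/
def FinPath.snoc (μ : G.FinPath) (e : E) (h : G.s e = μ.range) : G.FinPath :=
  ⟨μ.src, μ.edges ++ [e], isPathFrom_append.2 ⟨μ.isPath, h, trivial⟩⟩

theorem FinPath.isBeginning_snoc (μ : G.FinPath) (e : E) (h : G.s e = μ.range) :
    G.IsBeginning μ (.fin (μ.snoc e h)) := ⟨rfl, List.prefix_append _ _⟩

/-- A proper extension of a path `μ` extends `μ` by some edge. -/
theorem IsBeginning.exists_snoc {μ ν : G.FinPath} (h : G.IsBeginning μ (.fin ν)) (hne : μ ≠ ν) :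
    ∃ e, ∃ he : G.s e = μ.range, G.IsBeginning (μ.snoc e he) (.fin ν) := by
  obtain ⟨h1, l, hl⟩ := h
  cases l with
  | nil => exact absurd (FinPath.ext h1 (by simpa using hl)) hne
  | cons e l =>
    have hp := ν.isPath
    rw [← hl, ← h1, isPathFrom_append] at hp
    exact ⟨e, hp.2.1, h1, l, by simpa [FinPath.snoc] using hl⟩

/-- Beginnings of one path that have equal length coincide. Hence a path is compatible with at most
one way to leave μ. -/
theorem snoc_injective {μ ν : G.FinPath} {e f : E} {he : G.s e = μ.range} {hf : G.s f = μ.range}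
    (h : G.IsBeginning (μ.snoc e he) (.fin ν)) (k : G.IsBeginning (μ.snoc f hf) (.fin ν)) :
    e = f := by
  have hl : (μ.snoc e he).edges.length = (μ.snoc f hf).edges.length := by simp [FinPath.snoc]
  have : μ.snoc e he = μ.snoc f hf := by
    rcases h.total k with l | l
    · exact l.eq_of_length_le hl.ge
    · exact (l.eq_of_length_le hl.le).symm
  simpa [FinPath.snoc] using congrArg FinPath.edges this

theorem exists_isBeginning (x : G.PathSpace) : ∃ μ, G.IsBeginning μ x := by
  cases x with
  | fin p => exact ⟨p, .refl p⟩
  | inf p => exact ⟨_, p.isBeginning_initial 0⟩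

/-- A path is determined by its beginnings. -/
theorem pathSpace_ext {x y : G.PathSpace}
    (h : ∀ μ, G.IsBeginning μ x ↔ G.IsBeginning μ y) : x = y := by
  -- A finite path bounds the length of its beginnings; an infinite path does not.
  have aux : ∀ (p : G.FinPath) (q : G.InfPath),
      ¬ ∀ μ, G.IsBeginning μ (.fin p) ↔ G.IsBeginning μ (.inf q) := by
    intro p q h
    have := ((h _).2 (q.isBeginning_initial (p.edges.length + 1))).length_le
    rw [q.length_initial] at this
    omega
  cases x with
  | fin p =>
    cases y with
    | fin q =>
      have h1 := (h p).1 (.refl p)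
      have h2 := (h q).2 (.refl q)
      rw [h1.eq_of_length_le h2.length_le]
    | inf q => exact (aux p q h).elim
  | inf p =>
    cases y with
    | fin q => exact (aux q p fun μ => (h μ).symm).elim
    | inf q =>
      have : p = q := Subtype.ext <| funext fun n => by
        have := ((h _).1 (p.isBeginning_initial (n + 1))).2 n (by simp [p.length_initial])
        simpa only [InfPath.initial, List.getElem_ofFn] using this
      rw [this]

/-- If no path of the finite set `F` is a beginning of the boundary path `x`, then each
beginning of `x` has an extension that is incompatible with all paths of `F`. -/
theorem exists_incompatible {x : G.PathSpace} (hx : x ∈ G.boundary) {F : Set G.FinPath}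
    (hF : F.Finite) (hFx : ∀ g ∈ F, ¬ G.IsBeginning g x) {μ : G.FinPath}
    (hμ : G.IsBeginning μ x) :
    ∃ ν, G.IsBeginning μ (.fin ν) ∧
      ∀ g ∈ F, ∀ κ, G.IsBeginning g (.fin κ) → ¬ G.IsBeginning ν (.fin κ) := by
  rcases hx with ⟨p, rfl⟩ | ⟨p, rfl, hp | hp⟩
  -- Infinite path: cut it at a length that no path of `F` exceeds. A path of `F` compatible with
  -- the segment would then be a beginning of it. The maximum with the length of μ keeps μ a
  -- beginning.
  · obtain ⟨N, hN⟩ := (hF.image fun g => g.edges.length).bddAbove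
    have hν := p.isBeginning_initial (max N μ.edges.length)
    have hl := p.length_initial (max N μ.edges.length)
    refine ⟨p.initial (max N μ.edges.length), ?_, fun g hg κ h1 h2 => ?_⟩
    · rcases hμ.total hν with h | h
      · exact h
      · rw [h.eq_of_length_le (by rw [hl]; exact le_max_right _ _)]
        exact .refl _
    · have hgN : g.edges.length ≤ N := hN ⟨g, hg, rfl⟩
      rcases h1.total h2 with h | h
      · exact hFx g hg (h.trans hν)
      · rw [h.eq_of_length_le (by rw [hl]; exact hgN.trans (le_max_left _ _))] at hν
        exact hFx g hg hν
  -- Sink: `p` has no proper extension.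
  · refine ⟨p, hμ, fun g hg κ h1 h2 => ?_⟩
    have : p = κ := by
      by_contra hne
      obtain ⟨e, he, -⟩ := h2.exists_snoc hne
      exact (Set.eq_empty_iff_forall_notMem.1 hp) e he
    subst this
    exact hFx g hg h1
  -- Infinite emitter: each path of `F` extends `p` through at most one edge, so some edge is
  -- avoided by all of them.
  · have hfin : {e | ∃ g ∈ F, ∃ he : G.s e = p.range,
        G.IsBeginning (p.snoc e he) (.fin g)}.Finite := by
      refine (hF.biUnion (t := fun g => {e | ∃ he : G.s e = p.range,
        G.IsBeginning (p.snoc e he) (.fin g)}) fun g _ => Set.Subsingleton.finite ?_).subset ?_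
      · rintro e ⟨he, h1⟩ f ⟨hf, h2⟩
        exact snoc_injective h1 h2
      · rintro e ⟨g, hg, h⟩
        exact Set.mem_biUnion hg h
    obtain ⟨e, he, hn⟩ := (hp.sdiff hfin).nonempty
    refine ⟨p.snoc e he, hμ.trans (p.isBeginning_snoc e he), fun g hg κ h1 h2 => ?_⟩
    rcases h1.total ((p.isBeginning_snoc e he).trans h2) with h | h
    · exact hFx g hg h
    · obtain ⟨f, hf, hfg⟩ := h.exists_snoc (by rintro rfl; exact hFx _ hg (.refl _))
      obtain rfl := snoc_injective (hfg.trans h1) h2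
      exact hn ⟨g, hg, hf, hfg⟩

/-- A nonempty set of compatible paths, closed under beginnings and under the extension beyond
regular vertices, is the set of beginnings of a boundary path. -/
theorem exists_boundary_path {Φ : Set G.FinPath} (hne : Φ.Nonempty)
    (hcl : ∀ μ ν, G.IsBeginning μ (.fin ν) → ν ∈ Φ → μ ∈ Φ)
    (htot : ∀ μ ∈ Φ, ∀ ν ∈ Φ, G.IsBeginning μ (.fin ν) ∨ G.IsBeginning ν (.fin μ))
    (hreg : ∀ μ ∈ Φ, ¬ G.IsSingular μ.range → ∃ e, ∃ he : G.s e = μ.range, μ.snoc e he ∈ Φ) :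
    ∃ x ∈ G.boundary, ∀ μ, μ ∈ Φ ↔ G.IsBeginning μ x := by
  by_cases hb : ∃ μ ∈ Φ, ∀ ν ∈ Φ, ν.edges.length ≤ μ.edges.length
  · obtain ⟨μ, hμ, hmax⟩ := hb
    refine ⟨.fin μ, Or.inr ⟨μ, rfl, ?_⟩, fun ν => ⟨fun hν => ?_, fun h => hcl _ _ h hμ⟩⟩
    · by_contra hs
      obtain ⟨e, he, h⟩ := hreg μ hμ hs
      have := hmax _ h
      simp [FinPath.snoc] at this
    · rcases htot μ hμ ν hν with h | h
      · rw [h.eq_of_length_le (hmax ν hν)]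
        exact .refl _
      · exact h
  · push Not at hb
    have hlong : ∀ n : ℕ, ∃ μ ∈ Φ, n < μ.edges.length := by
      intro n
      induction n with
      | zero =>
        obtain ⟨μ, hμ⟩ := hne
        obtain ⟨ν, hν, h⟩ := hb μ hμ
        exact ⟨ν, hν, by omega⟩
      | succ n ih =>
        obtain ⟨μ, hμ, hn⟩ := ih
        obtain ⟨ν, hν, h⟩ := hb μ hμ
        exact ⟨ν, hν, by omega⟩
    -- `m n` is strictly longer than n, so it has an edge at index n. By compatibility that edge is
    -- the same in all members of Φ that reach this index, and the infinite path is glued from these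
    -- edges.
    choose m hm hlen using hlong
    have hget : ∀ ν ∈ Φ, ∀ i (hi : i < ν.edges.length), ν.edges[i] = (m i).edges[i]'(hlen i) := by
      intro ν hν i hi
      rcases htot ν hν (m i) (hm i) with h | h
      · exact h.2.getElem hi
      · exact (h.2.getElem (hlen i)).symm
    let p : G.InfPath := ⟨fun i => (m i).edges[i]'(hlen i), fun i => by
      have hi := hlen (i + 1)
      change G.r ((m i).edges[i]'(hlen i)) = _
      rw [← hget _ (hm (i + 1)) i (by omega)]
      exact (m (i + 1)).isPath.range_getElem i hi⟩
    have hsrc : ∀ n, (m n).src = G.s (p.1 0) := by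
      intro n
      have h0 : 0 < (m n).edges.length := by have := hlen n; omega
      rw [← (m n).isPath.source_getElem_zero h0, hget _ (hm n) 0 h0]
    have hbeg : ∀ n, G.IsBeginning (m n) (.inf p) := fun n => ⟨hsrc n, hget _ (hm n)⟩
    refine ⟨.inf p, Or.inl ⟨p, rfl⟩, fun ν => ⟨fun hν => ?_, fun h => ?_⟩⟩
    · refine ⟨?_, hget ν hν⟩
      rw [← hsrc ν.edges.length]
      rcases htot ν hν _ (hm ν.edges.length) with h | h
      · exact h.1
      · exact h.1.symm
    · refine hcl ν (m ν.edges.length) ?_ (hm _)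
      rcases h.total (hbeg ν.edges.length) with h | h
      · exact h
      · exact absurd h.length_le (hlen _).not_ge

/-! ### Semilattices of finite unions of cylinders -/

/-- A representation of a semilattice with zero by finite unions of cylinder sets
`{ν | μ is a beginning of ν}`, in which all cylinder sets occur. -/
structure CylinderRep (G : DirGraph V E) (P : Type*) [SemilatticeInf P] [OrderBot P] where
  /-- the set of paths that represents an element -/
  paths : P → Set G.FinPath
  injective : Function.Injective paths
  paths_bot : paths ⊥ = ∅
  paths_inf : ∀ x y, paths (x ⊓ y) = paths x ∩ paths y
  /-- the element that represents a cylinder set -/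
  cyl : G.FinPath → P
  mem_cyl : ∀ μ ν, ν ∈ paths (cyl μ) ↔ G.IsBeginning μ (.fin ν)
  exists_generators : ∀ x, ∃ F : Finset G.FinPath, ∀ ν, ν ∈ paths x ↔
    ∃ μ ∈ F, G.IsBeginning μ (.fin ν)

theorem sup_eq_true_iff {ι : Type*} (Z : Finset ι) (φ : ι → Bool) :
    Z.sup φ = true ↔ ∃ z ∈ Z, φ z = true := by
  classical
  induction Z using Finset.induction_on with
  | empty => simp
  | insert a Z _ ih => simp [Finset.sup_insert, ih]

namespace CylinderRep

variable {P : Type*} [SemilatticeInf P] [OrderBot P] (R : CylinderRep G P)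

theorem le_iff {x y : P} : x ≤ y ↔ R.paths x ⊆ R.paths y := by
  rw [← inf_eq_left, ← Set.inter_eq_left, ← R.paths_inf]
  exact R.injective.eq_iff.symm

theorem ne_bot_iff {x : P} : x ≠ ⊥ ↔ (R.paths x).Nonempty := by
  rw [Set.nonempty_iff_ne_empty, ← R.paths_bot]
  exact R.injective.ne_iff.symm

theorem paths_upward {x : P} {μ ν : G.FinPath} (h : μ ∈ R.paths x)
    (k : G.IsBeginning μ (.fin ν)) : ν ∈ R.paths x := by
  obtain ⟨F, hF⟩ := R.exists_generators x
  obtain ⟨g, hg, h1⟩ := (hF _).1 h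
  exact (hF _).2 ⟨g, hg, h1.trans k⟩

theorem cyl_le_iff {x : P} {μ : G.FinPath} : R.cyl μ ≤ x ↔ μ ∈ R.paths x := by
  rw [R.le_iff]
  refine ⟨fun h => h ((R.mem_cyl μ μ).2 (.refl μ)), fun h ν hν => ?_⟩
  exact R.paths_upward h ((R.mem_cyl μ ν).1 hν)

/-- Every nonzero element lies above a cylinder, so the cover condition need only be tested on
cylinders. -/
theorem isCover_iff {x : P} {Z : Set P} : IsCover Z x ↔ (∀ z ∈ Z, z ≤ x) ∧
    ∀ μ ∈ R.paths x, ∃ z ∈ Z, ∃ ν ∈ R.paths z, G.IsBeginning μ (.fin ν) := by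
  refine and_congr_right fun _ => ⟨fun h μ hμ => ?_, fun h y hy hy0 => ?_⟩
  · obtain ⟨z, hz, hne⟩ := h (R.cyl μ) (R.cyl_le_iff.2 hμ)
      (R.ne_bot_iff.2 ⟨μ, (R.mem_cyl μ μ).2 (.refl μ)⟩)
    rw [R.ne_bot_iff, R.paths_inf] at hne
    obtain ⟨ν, h1, h2⟩ := hne
    exact ⟨z, hz, ν, h1, (R.mem_cyl μ ν).1 h2⟩
  · obtain ⟨μ, hμ⟩ := R.ne_bot_iff.1 hy0
    obtain ⟨z, hz, ν, h1, h2⟩ := h μ (R.le_iff.1 hy hμ)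
    refine ⟨z, hz, R.ne_bot_iff.2 ⟨ν, ?_⟩⟩
    rw [R.paths_inf]
    exact ⟨h1, R.paths_upward hμ h2⟩

/-! ### Characters of paths -/

open Classical in
/-- The character of a path `x`. -/
noncomputable def char (x : G.PathSpace) (e : P) : Bool :=
  decide (∃ μ ∈ R.paths e, G.IsBeginning μ x)

theorem char_eq_true {x : G.PathSpace} {e : P} :
    R.char x e = true ↔ ∃ μ ∈ R.paths e, G.IsBeginning μ x := by
  simp [char]

theorem char_cyl (x : G.PathSpace) (μ : G.FinPath) : R.char x (R.cyl μ) = G.theta x μ := by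
  rw [Bool.eq_iff_iff, char_eq_true]
  simp only [theta, decide_eq_true_eq]
  refine ⟨fun ⟨ν, h1, h2⟩ => ((R.mem_cyl μ ν).1 h1).trans h2,
    fun h => ⟨μ, (R.mem_cyl μ μ).2 (.refl μ), h⟩⟩

/-- Each value is a finite join of coordinates of `theta`; continuity rests on this. -/
theorem char_eq_sup (x : G.PathSpace) {e : P} {F : Finset G.FinPath}
    (hF : ∀ ν, ν ∈ R.paths e ↔ ∃ μ ∈ F, G.IsBeginning μ (.fin ν)) :
    R.char x e = F.sup (G.theta x) := by
  rw [Bool.eq_iff_iff, char_eq_true, sup_eq_true_iff]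
  simp only [theta, decide_eq_true_eq]
  constructor
  · rintro ⟨ν, h1, h2⟩
    obtain ⟨μ, hμ, h3⟩ := (hF ν).1 h1
    exact ⟨μ, hμ, h3.trans h2⟩
  · rintro ⟨μ, hμ, h⟩
    exact ⟨μ, (hF μ).2 ⟨μ, hμ, .refl μ⟩, h⟩

theorem isCharacter_char (x : G.PathSpace) : IsCharacter (R.char x) where
  ne_zero := by
    obtain ⟨μ, hμ⟩ := exists_isBeginning x
    refine ⟨R.cyl μ, ?_⟩
    simp [char_cyl, theta, hμ]
  map_bot := by simp [char, R.paths_bot]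
  map_inf e f := by
    rw [Bool.eq_iff_iff]
    simp only [Bool.min_eq_and, Bool.and_eq_true, char_eq_true, R.paths_inf]
    constructor
    · rintro ⟨μ, ⟨h1, h2⟩, h⟩
      exact ⟨⟨μ, h1, h⟩, ⟨μ, h2, h⟩⟩
    -- Both witnesses are beginnings of `x`, so the longer one lies in both sets, which are closed
    -- under extension.
    · rintro ⟨⟨μ, h1, hμ⟩, ⟨ν, h2, hν⟩⟩
      rcases hμ.total hν with h | h
      · exact ⟨ν, ⟨R.paths_upward h1 h, h2⟩, hν⟩
      · exact ⟨μ, ⟨h1, R.paths_upward h2 h⟩, hμ⟩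

theorem isTight_char {x : G.PathSpace} (hx : x ∈ G.boundary) : IsTight (R.char x) where
  toIsCharacter := R.isCharacter_char x
  sup_cover e Z hZ := by
    rw [R.isCover_iff] at hZ
    rw [Bool.eq_iff_iff, sup_eq_true_iff]
    simp only [char_eq_true]
    constructor
    · rintro ⟨z, hz, μ, hμ, h⟩
      exact ⟨μ, R.le_iff.1 (hZ.1 z hz) hμ, h⟩
    · rintro ⟨μ, hμ, h⟩
      by_contra hcon
      choose F hF using R.exists_generators
      -- Applied to the generators of all members of `Z` together; the cover condition at ν then
      -- yields an extension of ν that also extends a generator.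
      obtain ⟨ν, h1, h2⟩ := exists_incompatible hx
        (Z.finite_toSet.biUnion (t := fun z => (F z : Set G.FinPath))
          fun z _ => (F z).finite_toSet)
        (fun g hg hgx => by
          obtain ⟨z, hz, hgz⟩ := Set.mem_iUnion₂.1 hg
          exact hcon ⟨z, hz, g, (hF z g).2 ⟨g, hgz, .refl g⟩, hgx⟩) h
      obtain ⟨z, hz, κ, hκ, hνκ⟩ := hZ.2 ν (R.paths_upward hμ h1)
      obtain ⟨g, hg, hgκ⟩ := (hF z κ).1 hκ
      exact h2 g (Set.mem_biUnion (Finset.mem_coe.2 hz) hg) κ hgκ hνκ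

/-! ### From tight characters to boundary paths -/

/-- The cylinders of the generators of `e` form a finite cover of `e`. -/
theorem map_eq_true_iff {φ : P → Bool} (hφ : IsTight φ) {e : P} {F : Finset G.FinPath}
    (hF : ∀ ν, ν ∈ R.paths e ↔ ∃ μ ∈ F, G.IsBeginning μ (.fin ν)) :
    φ e = true ↔ ∃ μ ∈ F, φ (R.cyl μ) = true := by
  classical
  rw [← hφ.sup_cover e (F.image R.cyl), sup_eq_true_iff]
  · simp
  · rw [R.isCover_iff]
    simp only [Finset.coe_image, Set.mem_image, Finset.mem_coe, forall_exists_index, and_imp,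
      forall_apply_eq_imp_iff₂, exists_exists_and_eq_and]
    refine ⟨fun μ hμ => R.cyl_le_iff.2 ((hF μ).2 ⟨μ, hμ, .refl μ⟩), fun ν hν => ?_⟩
    obtain ⟨μ, hμ, h⟩ := (hF ν).1 hν
    exact ⟨μ, hμ, ν, (R.mem_cyl μ ν).2 h, .refl ν⟩

/-- At a regular vertex the one-edge extensions of μ are finite in number, and their cylinders cover
that of μ. -/
theorem exists_map_snoc {φ : P → Bool} (hφ : IsTight φ) {μ : G.FinPath}
    (hμ : φ (R.cyl μ) = true) (hs : ¬ G.IsSingular μ.range) :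
    ∃ e, ∃ he : G.s e = μ.range, φ (R.cyl (μ.snoc e he)) = true := by
  classical
  rw [IsSingular, not_or, Set.not_infinite] at hs
  obtain ⟨hne, hfin⟩ := hs
  obtain ⟨e₀, he₀⟩ := Set.nonempty_iff_ne_empty.2 hne
  let Z : Finset P := hfin.toFinset.attach.image fun e =>
    R.cyl (μ.snoc e.1 (hfin.mem_toFinset.1 e.2))
  have hmem : ∀ z, z ∈ Z ↔ ∃ e, ∃ he : G.s e = μ.range, R.cyl (μ.snoc e he) = z := by
    intro z
    simp [Z]
  have hZ : IsCover (Z : Set P) (R.cyl μ) := by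
    rw [R.isCover_iff]
    simp only [Finset.mem_coe, hmem]
    constructor
    · rintro _ ⟨e, he, rfl⟩
      exact R.cyl_le_iff.2 ((R.mem_cyl _ _).2 (μ.isBeginning_snoc e he))
    · intro ν hν
      rw [R.mem_cyl] at hν
      by_cases hμν : μ = ν
      · subst hμν
        -- The path μ lies in none of the smaller cylinders, so meeting one requires that its range
        -- is not a sink.
        exact ⟨_, ⟨e₀, he₀, rfl⟩, μ.snoc e₀ he₀, (R.mem_cyl _ _).2 (.refl _),
          μ.isBeginning_snoc e₀ he₀⟩
      · obtain ⟨e, he, h⟩ := hν.exists_snoc hμν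
        exact ⟨_, ⟨e, he, rfl⟩, ν, (R.mem_cyl _ _).2 h, .refl ν⟩
  rw [← hφ.sup_cover _ Z hZ, sup_eq_true_iff] at hμ
  obtain ⟨z, hz, h⟩ := hμ
  obtain ⟨e, he, rfl⟩ := (hmem z).1 hz
  exact ⟨e, he, h⟩

/-- Every tight character is the character of a boundary path. -/
theorem exists_char_eq {φ : P → Bool} (hφ : IsTight φ) :
    ∃ x ∈ G.boundary, R.char x = φ := by
  have hinf : ∀ e f, φ e = true → φ f = true → φ (e ⊓ f) = true := by
    intro e f he hf
    simp [hφ.map_inf, he, hf]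
  have hmono : ∀ e f, e ≤ f → φ e = true → φ f = true := by
    intro e f hef he
    have := hφ.map_inf e f
    rw [inf_eq_left.2 hef, he] at this
    simpa using this.symm
  obtain ⟨x, hx, h⟩ := exists_boundary_path (G := G) (Φ := {μ | φ (R.cyl μ) = true})
    (by
      obtain ⟨e, he⟩ := hφ.ne_zero
      obtain ⟨F, hF⟩ := R.exists_generators e
      obtain ⟨μ, -, hμ⟩ := (R.map_eq_true_iff hφ hF).1 (by simpa using he)
      exact ⟨μ, hμ⟩)
    (fun μ ν h hν => hmono _ _ (R.cyl_le_iff.2 ((R.mem_cyl μ ν).2 h)) hν)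
    (fun μ hμ ν hν => by
      -- A nonzero meet contains a common extension of μ and ν, which makes them comparable.
      have hne : R.cyl μ ⊓ R.cyl ν ≠ ⊥ := by
        intro h0
        have := hinf _ _ hμ hν
        rw [h0, hφ.map_bot] at this
        simp at this
      rw [R.ne_bot_iff, R.paths_inf] at hne
      obtain ⟨κ, h1, h2⟩ := hne
      exact ((R.mem_cyl _ _).1 h1).total ((R.mem_cyl _ _).1 h2))
    (fun μ hμ hs => R.exists_map_snoc hφ hμ hs)
  refine ⟨x, hx, funext fun e => ?_⟩
  obtain ⟨F, hF⟩ := R.exists_generators e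
  rw [R.char_eq_sup x hF, Bool.eq_iff_iff, sup_eq_true_iff, R.map_eq_true_iff hφ hF]
  refine exists_congr fun μ => and_congr_right fun _ => ?_
  simpa only [theta, decide_eq_true_eq, Set.mem_ofPred_eq] using (h μ).symm

/-- The tight character of a boundary path. -/
noncomputable def tightChar (x : G.boundary) : TightSpectrum P :=
  ⟨R.char x.1, R.isTight_char x.2⟩

theorem bijective_tightChar : Function.Bijective R.tightChar := by
  constructor
  · intro x y h
    have h' : R.char x.1 = R.char y.1 := congrArg Subtype.val h
    refine Subtype.ext (pathSpace_ext fun μ => ?_)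
    have := congrFun h' (R.cyl μ)
    simpa [char_cyl, theta] using this
  · rintro ⟨φ, hφ⟩
    obtain ⟨x, hx, h⟩ := R.exists_char_eq hφ
    exact ⟨⟨x, hx⟩, Subtype.ext h⟩

theorem continuous_tightChar : Continuous R.tightChar := by
  refine Continuous.subtype_mk (continuous_pi fun e => ?_) _
  obtain ⟨F, hF⟩ := R.exists_generators e
  simp only [R.char_eq_sup _ hF]
  have hθ : Continuous G.theta := continuous_induced_dom
  have hsup : Continuous fun t : G.FinPath → Bool => F.sup t := by
    clear hF
    classical
    induction F using Finset.induction_on with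
    | empty => exact continuous_const
    | insert a F _ ih =>
      simp only [Finset.sup_insert]
      exact (continuous_of_discreteTopology (f := fun b : Bool × Bool => b.1 ⊔ b.2)).comp
        ((continuous_apply a).prodMk ih)
  exact hsup.comp (hθ.comp continuous_subtype_val)

/-- The tight spectrum is homeomorphic to the boundary path space. -/
noncomputable def homeomorph : TightSpectrum P ≃ₜ G.boundary where
  toEquiv := (Equiv.ofBijective _ R.bijective_tightChar).symm
  continuous_invFun := R.continuous_tightChar
  continuous_toFun := by
    refine Continuous.subtype_mk (f := fun φ : TightSpectrum P =>
      ((Equiv.ofBijective _ R.bijective_tightChar).symm φ).1) (continuous_induced_rng.2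
        (continuous_pi fun μ => ?_)) _
    -- The μ-coordinate of the inverse map is evaluation at the cylinder of μ.
    have : ∀ φ : TightSpectrum P,
        G.theta ((Equiv.ofBijective _ R.bijective_tightChar).symm φ).1 μ = φ.1 (R.cyl μ) := by
      intro φ
      rw [← R.char_cyl]
      exact congrFun (congrArg Subtype.val
        ((Equiv.ofBijective _ R.bijective_tightChar).apply_symm_apply φ)) (R.cyl μ)
    refine Continuous.congr ?_ fun φ => (this φ).symm
    exact (continuous_apply (R.cyl μ)).comp continuous_subtype_val

end CylinderRep

/-! ### The idempotents of the semigroup of a graph -/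

/-- The first edge fixes the source; a path without edges is its own range. -/
theorem FinPath.ext_range {μ ν : G.FinPath} (h : μ.edges = ν.edges) (k : μ.range = ν.range) :
    μ = ν := by
  obtain ⟨v, l, hl⟩ := μ
  obtain ⟨w, m, hm⟩ := ν
  obtain rfl : l = m := h
  cases l with
  | nil => exact FinPath.ext k rfl
  | cons e l => exact FinPath.ext (hl.1.symm.trans hm.1) rfl

open LabelledSpace

theorem mem_relRange_iff {A : Set V} {α : List E} {v : V} :
    v ∈ G.labelledSpace.relRange A α ↔ ∃ p : G.FinPath, p.edges = α ∧ p.src ∈ A ∧ p.range = v := by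
  refine exists_congr fun p => ?_
  rw [show List.map G.labelledSpace.lab p.edges = p.edges from List.map_id _]
  rfl

/-- Since A ⊆ r(α), any path that starts in A can be preceded by a path with label α. -/
theorem rel_triple_iff {α β : List E} {A : Set V} (h : G.labelledSpace.IsTriple α A β)
    (ν : G.FinPath) : (∃ κ, ν.edges = α ++ κ ∧ ν.range ∈ G.labelledSpace.relRange A κ) ↔
      ∃ μ : G.FinPath, μ.edges = α ∧ μ.range ∈ A ∧ G.IsBeginning μ (.fin ν) := by
  constructor
  · rintro ⟨κ, h1, h2⟩
    obtain ⟨π, rfl, hπ, hr⟩ := mem_relRange_iff.1 h2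
    obtain ⟨μ, rfl, -, hμ⟩ := mem_relRange_iff.1 (h.subset_left hπ)
    have hp : G.IsPathFrom μ.src (μ.edges ++ π.edges) := by
      refine isPathFrom_append.2 ⟨μ.isPath, ?_⟩
      change G.IsPathFrom μ.range _
      rw [hμ]
      exact π.isPath
    have : ν = ⟨μ.src, μ.edges ++ π.edges, hp⟩ := by
      refine FinPath.ext_range h1 (hr.symm.trans ?_)
      change _ = G.endpoint μ.src (μ.edges ++ π.edges)
      rw [endpoint_append]
      change G.endpoint π.src π.edges = G.endpoint μ.range π.edges
      rw [hμ]
    subst this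
    exact ⟨μ, rfl, hμ ▸ hπ, rfl, List.prefix_append _ _⟩
  · rintro ⟨μ, rfl, hμ, hs, κ, hκ⟩
    have hp := ν.isPath
    rw [← hκ, ← hs, isPathFrom_append] at hp
    refine ⟨κ, hκ.symm, mem_relRange_iff.2 ⟨⟨_, κ, hp.2⟩, rfl, hμ, ?_⟩⟩
    change G.endpoint (G.endpoint μ.src μ.edges) κ = G.endpoint ν.src ν.edges
    rw [← endpoint_append, hs, hκ]

/-- The relation of `x` is a partial injection on words: `rel_unique` holds for `x` and for its
star. An idempotent partial injection is a partial identity. -/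
theorem rel_eq_of_idempotent
    (hw : G.labelledSpace.IsWeaklyLeftResolving G.labelledSpace.acf)
    {x : G.labelledSpace.Semi} (hx : x * x = x) {p q : List E} {v : V}
    (h : x.SRel p v q) : p = q := by
  have h' := h
  rw [← hx, Semi.rel_mul hw] at h'
  obtain ⟨q', h1, h2⟩ := h'
  obtain rfl := Semi.rel_unique h h1
  rw [← Semi.rel_star] at h h2
  exact Semi.rel_unique h h2

variable (hw : G.labelledSpace.IsWeaklyLeftResolving G.labelledSpace.acf)

/-- The set of finite paths that represents an idempotent. -/
def idempotentPaths (e : G.labelledSpace.ESemi hw) : Set G.FinPath :=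
  {p | e.1.SRel p.edges p.range p.edges}

/-- The relation of an idempotent is diagonal, and each word and vertex in it are the edges and
range of an actual path. So the set of paths recovers the relation, which is faithful. -/
theorem idempotentPaths_injective : Function.Injective (idempotentPaths hw) := by
  have aux : ∀ e f : G.labelledSpace.ESemi hw, idempotentPaths hw e = idempotentPaths hw f →
      ∀ p v q, e.1.SRel p v q → f.1.SRel p v q := by
    intro e f hef p v q h
    obtain rfl := rel_eq_of_idempotent hw e.2 h
    have hv : v ∈ G.labelledSpace.relRange Set.univ p := by
      obtain ⟨x, hx⟩ := e
      cases x with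
      | zero => exact h.elim
      | triple α A β k =>
        obtain ⟨κ, rfl, -, h⟩ := h
        rw [LabelledGraph.relRange_append]
        exact LabelledGraph.relRange_mono k.subset_left _ h
    obtain ⟨π, rfl, -, rfl⟩ := mem_relRange_iff.1 hv
    exact hef.subset h
  intro e f hef
  exact Subtype.ext (Semi.rel_injective fun p v q => ⟨aux e f hef p v q, aux f e hef.symm p v q⟩)

theorem isTriple_finPath (μ : G.FinPath) :
    G.labelledSpace.IsTriple μ.edges {μ.range} μ.edges := by
  have h : {μ.range} ⊆ G.labelledSpace.wordRange μ.edges :=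
    Set.singleton_subset_iff.2 (mem_relRange_iff.2 ⟨μ, rfl, trivial, rfl⟩)
  exact ⟨LabelledGraph.isLabelledPath_of_mem (h rfl), LabelledGraph.isLabelledPath_of_mem (h rfl),
    Set.finite_singleton _, h, h, Set.singleton_nonempty _⟩

/-- The idempotent `(μ, {r(μ)}, μ)` of a finite path. -/
def cylinderIdempotent (μ : G.FinPath) : G.labelledSpace.ESemi hw :=
  ⟨.triple μ.edges {μ.range} μ.edges (isTriple_finPath μ), by
    apply Semi.rel_injective
    intro p v q
    refine (Semi.rel_mul hw _ _ p v q).trans ⟨?_, fun h => ?_⟩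
    · rintro ⟨q', ⟨κ, rfl, rfl, h⟩, h'⟩
      exact h'
    · obtain ⟨κ, rfl, rfl, h⟩ := h
      exact ⟨_, ⟨κ, rfl, rfl, h⟩, ⟨κ, rfl, rfl, h⟩⟩⟩

theorem mem_idempotentPaths_triple {α β : List E} {A : Set V}
    (h : G.labelledSpace.IsTriple α A β)
    (hx : (Semi.triple α A β h : G.labelledSpace.Semi) * .triple α A β h = .triple α A β h)
    (ν : G.FinPath) : ν ∈ idempotentPaths hw ⟨.triple α A β h, hx⟩ ↔
      ∃ μ : G.FinPath, μ.edges = α ∧ μ.range ∈ A ∧ G.IsBeginning μ (.fin ν) := by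
  obtain ⟨v, hv⟩ := h.nonempty
  -- The triple relates α to β through the empty extension.
  obtain rfl : α = β := rel_eq_of_idempotent hw hx (v := v)
    ⟨[], by simp, by simp, by rwa [LabelledGraph.relRange_nil]⟩
  rw [← rel_triple_iff h]
  exact exists_congr fun κ => ⟨fun ⟨a, _, b⟩ => ⟨a, b⟩, fun ⟨a, b⟩ => ⟨a, a, b⟩⟩

/-- The representation of the idempotents by sets of finite paths. -/
noncomputable def idempotentRep : CylinderRep G (G.labelledSpace.ESemi hw) where
  paths := idempotentPaths hw
  injective := idempotentPaths_injective hw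
  paths_bot := rfl
  paths_inf e f := by
    ext π
    refine (Semi.rel_mul hw e.1 f.1 _ _ _).trans ⟨?_, fun h => ⟨_, h.1, h.2⟩⟩
    rintro ⟨q, h1, h2⟩
    obtain rfl := rel_eq_of_idempotent hw e.2 h1
    exact ⟨h1, h2⟩
  cyl := cylinderIdempotent hw
  mem_cyl μ ν := by
    refine (mem_idempotentPaths_triple hw _ _ ν).trans ⟨?_, fun h => ⟨μ, rfl, rfl, h⟩⟩
    rintro ⟨μ', h1, h2, h⟩
    rwa [FinPath.ext_range h1 h2] at h
  exists_generators := by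
    rintro ⟨x, hx⟩
    cases x with
    | zero => exact ⟨∅, fun ν => ⟨fun h => h.elim, by simp⟩⟩
    | triple α A β h =>
      -- The range map is injective on paths with label α and sends this set into the finite set A.
      have hfin : {μ : G.FinPath | μ.edges = α ∧ μ.range ∈ A}.Finite := by
        refine Set.Finite.of_finite_image (f := FinPath.range)
          ((show A.Finite from h.mem).subset ?_) ?_
        · rintro _ ⟨μ, hμ, rfl⟩
          exact hμ.2
        · intro μ hμ ν hν hr
          exact FinPath.ext_range (hμ.1.trans hν.1.symm) hr
      refine ⟨hfin.toFinset, fun ν => ?_⟩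
      rw [mem_idempotentPaths_triple hw h hx]
      simp [and_assoc]

end DirGraph

end LabelledSpaces

theorem mainTheorem8 {V : Type*} {E : Type*} (G : LabelledSpaces.DirGraph V E) :
    G.selfLabelled.IsAccommodating (LabelledSpaces.DirGraph.finiteSets V) ∧
    (∀ A ∈ LabelledSpaces.DirGraph.finiteSets V, ∀ B ∈ LabelledSpaces.DirGraph.finiteSets V,
      A \ B ∈ LabelledSpaces.DirGraph.finiteSets V) ∧
    ∃ hw : G.labelledSpace.IsWeaklyLeftResolving G.labelledSpace.acf,
      Nonempty (LabelledSpaces.TightSpectrum (G.labelledSpace.ESemi hw) ≃ₜ G.boundary) :=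
  ⟨G.finiteSets_isAccommodating, fun _ hA _ _ => Set.Finite.sdiff hA,
    G.finiteSets_isWeaklyLeftResolving,
    ⟨(LabelledSpaces.DirGraph.idempotentRep G.finiteSets_isWeaklyLeftResolving).homeomorph⟩⟩
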